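/- Let $\Lambda=\{m(1,0)+k(\tfrac12,\tfrac{\sqrt7}{2}) : m,k\in\mathbb Z\}\subset\mathbb R^2$, i.e. the ring of integers of $\mathbb Q(\sqrt{-7})$ embedded in the Euclidean plane. The distances determined by a set of points are the Euclidean distances between two distinct points of the set. (1) Every $4$ distinct points of $\Lambda$ determine at least $3$ distinct distances. (2) For every integer $n\ge 0$ there is a set $P_n$ consisting of $n$ points of $\Lambda$ nearest to the origin, that is, $P_n\subset\Lambda$, $|P_n|=n$ and $\|p\|\le\|q\|$ for all $p\in P_n$ and $q\in\Lambda\setminus P_n$. For every such $P_n$ (however ties are broken), every $4$ distinct points of $P_n$ determine at least $3$ distinct distances. (3) There is an absolute constant $C>0$ such that for every $n\ge 2$ and every such $P_n$, the number of distinct distances determined by $P_n$ is at most $C\,n/\sqrt{\log n}$. In particular, for every $n \geq 2$ there is a set of $n$ points in $\mathbb R^2$ of which every $4$ points determine at least $3$ distances, while the total number of distinct distances is $O(n/\sqrt{\log n})$. -/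

import Mathlib

/-- The Euclidean plane. -/
abbrev Plane : Type := EuclideanSpace ℝ (Fin 2)

/-- The ring of integers of `ℚ(√-7)`, embedded in the plane: the lattice of all points
`m (1, 0) + k (1/2, √7/2)` with integers `m`, `k`. -/
def latticeSeven : Set Plane :=
  {u | ∃ m k : ℤ, u = (m : ℝ) • !₂[(1 : ℝ), 0] + (k : ℝ) • !₂[(1 / 2 : ℝ), Real.sqrt 7 / 2]}

/-- The distances determined by `S`: those between two distinct points of `S`. -/
def distances (S : Set Plane) : Set ℝ :=
  {d | ∃ x ∈ S, ∃ y ∈ S, x ≠ y ∧ dist x y = d}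

/-- Every four distinct points of `S` determine at least three distinct distances. -/
def FourPointsThreeDistances (S : Set Plane) : Prop :=
  ∀ T : Finset Plane, (T : Set Plane) ⊆ S → T.card = 4 →
    3 ≤ (distances (T : Set Plane)).ncard

/-- `P` consists of `n` points of the lattice nearest to the origin, ties being broken
arbitrarily. -/
def IsNearestLatticePoints (n : ℕ) (P : Finset Plane) : Prop :=
  (P : Set Plane) ⊆ latticeSeven ∧ P.card = n ∧
    ∀ p ∈ P, ∀ q ∈ latticeSeven, q ∉ P → ‖p‖ ≤ ‖q‖

/-
The lattice is the ring of integers of `ℚ(√-7)`, on which the squared Euclidean length is the norm,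
so squared distances are integers.

If four points of the plane span only two distances and no three of them form an equilateral
triangle, then they are `w, x, y, z` with `w x`, `x y`, `y z` of one length and `w y`, `x z` of the
other. The vanishing of a Gram determinant shows that they form a square or four vertices of a
regular pentagon. Area considerations for the triangle and the square, and the golden ratio of the
pentagon, would make `3 * 7`, `7` or `5` a square.

The squared distances of the `n` nearest points are at most `16 * n`. As norms they are divisible
only to even powers by the inert primes, those with `χ p = -1` for the quadratic character `χ`
modulo `7`. Up to a square and a divisor of `7` such a number is a product of split primes. The
reciprocals of the products of split primes up to `N` have sum `O(√(log N))`, as the square of this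
sum is bounded by a partial sum of `ζ (s) * L (s, χ)` at `s = 1`, and a Chebyshev-type bound turns
this into a count `O(N / √(log N))`.
-/

section

open Finset

section QuadraticNorm

variable {R : Type*} [CommRing R] {a b : R}

lemma quadraticNorm_sub_comm (x y : QuadraticAlgebra R a b) : (x - y).norm = (y - x).norm := by
  rw [← QuadraticAlgebra.norm_neg, neg_sub]

lemma quadraticNorm_add_add_quadraticNorm_sub (x y : QuadraticAlgebra R a b) :
    (x + y).norm + (x - y).norm = 2 * (x.norm + y.norm) := by
  simp only [QuadraticAlgebra.norm_def, QuadraticAlgebra.re_add, QuadraticAlgebra.im_add,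
    QuadraticAlgebra.re_sub, QuadraticAlgebra.im_sub]
  ring

lemma four_mul_quadraticNorm (x : QuadraticAlgebra R a b) :
    4 * x.norm = (2 * x.re + b * x.im) ^ 2 - (b ^ 2 + 4 * a) * x.im ^ 2 := by
  rw [QuadraticAlgebra.norm_def]
  ring

lemma quadraticNorm_heron (x y z : QuadraticAlgebra R a b) :
    4 * (x - y).norm * (x - z).norm - ((x - y).norm + (x - z).norm - (y - z).norm) ^ 2 =
      -(b ^ 2 + 4 * a) * ((x - y).re * (x - z).im - (x - z).re * (x - y).im) ^ 2 := by
  simp only [QuadraticAlgebra.norm_def, QuadraticAlgebra.re_sub, QuadraticAlgebra.im_sub]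
  ring

/- The Gram determinant of three vectors in a plane vanishes; each inner product is half of
`u.norm + v.norm - (u - v).norm`. -/
lemma quadraticNorm_gram (u v w : QuadraticAlgebra R a b) :
    4 * u.norm * v.norm * w.norm +
        (u.norm + v.norm - (u - v).norm) * (v.norm + w.norm - (v - w).norm) *
          (u.norm + w.norm - (u - w).norm) =
      u.norm * (v.norm + w.norm - (v - w).norm) ^ 2 +
        v.norm * (u.norm + w.norm - (u - w).norm) ^ 2 +
        w.norm * (u.norm + v.norm - (u - v).norm) ^ 2 := by
  simp only [QuadraticAlgebra.norm_def, QuadraticAlgebra.re_sub, QuadraticAlgebra.im_sub]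
  ring

/- The first factor vanishes when `w x z y` is a parallelogram (parallelogram law), the second when
`w x y z` is an isosceles trapezoid (Ptolemy's theorem). -/
lemma quadraticNorm_equilateral_path {w x y z : QuadraticAlgebra R a b} {α β : R}
    (hwx : (w - x).norm = α) (hxy : (x - y).norm = α) (hyz : (y - z).norm = α)
    (hwy : (w - y).norm = β) (hxz : (x - z).norm = β) :
    ((w - z).norm - α - 2 * β) * ((β - α) ^ 2 - α * (w - z).norm) = 0 := by
  have gram := quadraticNorm_gram (w - z) (x - z) (y - z)
  simp only [sub_sub_sub_cancel_right, hwx, hxy, hyz, hwy, hxz] at gram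
  linear_combination gram

end QuadraticNorm

lemma isSquare_of_sq_eq_mul_sq {R : Type*} [CommRing R] [IsDomain R] [IsIntegrallyClosed R]
    {c x y : R} (hy : y ≠ 0) (h : x ^ 2 = c * y ^ 2) : IsSquare c := by
  obtain ⟨k, rfl⟩ :=
    (IsIntegrallyClosed.pow_dvd_pow_iff two_ne_zero).mp (Dvd.intro_left c h.symm)
  exact ⟨k, mul_right_cancel₀ (pow_ne_zero 2 hy) (by linear_combination -h)⟩

/-- The squared distances between distinct points of `s`, the norm of a quadratic algebra playing
the role of the squared length. -/
def sqDistances {R : Type*} [CommRing R] [DecidableEq R] {a b : R}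
    (s : Finset (QuadraticAlgebra R a b)) : Finset R :=
  s.offDiag.image fun p => (p.1 - p.2).norm

lemma quadraticNorm_sub_eq_or_eq {R : Type*} [CommRing R] [DecidableEq R] {a b A B : R}
    {s : Finset (QuadraticAlgebra R a b)} (hs : sqDistances s ⊆ {A, B})
    {x y : QuadraticAlgebra R a b} (hx : x ∈ s) (hy : y ∈ s) (hxy : x ≠ y) :
    (x - y).norm = A ∨ (x - y).norm = B := by
  simpa only [mem_insert, mem_singleton] using
    hs (mem_image.mpr ⟨(x, y), mem_offDiag.mpr ⟨hx, hy, hxy⟩, rfl⟩)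

section NegativeDiscriminant

variable {R : Type*} [CommRing R] [LinearOrder R] [IsStrictOrderedRing R] {a b : R}
  {w x y z : QuadraticAlgebra R a b}

lemma quadraticNorm_pos (hΔ : b ^ 2 + 4 * a < 0) (hx : x ≠ 0) : 0 < x.norm := by
  suffices 0 < 4 * x.norm by linarith
  rw [four_mul_quadraticNorm]
  rcases eq_or_ne x.im 0 with him | him
  · have hre : x.re ≠ 0 := fun hre => hx (QuadraticAlgebra.ext hre him)
    have : 0 < (2 * x.re) ^ 2 := by positivity
    simpa only [him, mul_zero, add_zero, ne_eq, OfNat.ofNat_ne_zero, not_false_eq_true, zero_pow,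
      sub_zero]
  · linarith [sq_nonneg (2 * x.re + b * x.im),
      mul_pos (neg_pos.mpr hΔ) (sq_pos_of_ne_zero him)]

lemma pos_of_mem_sqDistances (hΔ : b ^ 2 + 4 * a < 0) {s : Finset (QuadraticAlgebra R a b)} {r : R}
    (hr : r ∈ sqDistances s) : 0 < r := by
  obtain ⟨⟨p, q⟩, hpq, rfl⟩ := mem_image.mp hr
  exact quadraticNorm_pos hΔ (sub_ne_zero.mpr (mem_offDiag.mp hpq).2.2)

variable [IsIntegrallyClosed R]

lemma isSquare_of_equilateral (hΔ : b ^ 2 + 4 * a < 0) (hxy : x ≠ y)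
    (hxz : (x - z).norm = (x - y).norm) (hyz : (y - z).norm = (x - y).norm) :
    IsSquare (-3 * (b ^ 2 + 4 * a)) := by
  have heron := quadraticNorm_heron x y z
  rw [hxz, hyz] at heron
  refine isSquare_of_sq_eq_mul_sq (quadraticNorm_pos hΔ (sub_ne_zero.mpr hxy)).ne'
    (x := (b ^ 2 + 4 * a) * ((x - y).re * (x - z).im - (x - z).re * (x - y).im)) ?_
  linear_combination (b ^ 2 + 4 * a) * heron

lemma isSquare_of_isosceles_right (hΔ : b ^ 2 + 4 * a < 0) (hxy : x ≠ y)
    (hxz : (x - z).norm = (x - y).norm) (hyz : (y - z).norm = 2 * (x - y).norm) :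
    IsSquare (-(b ^ 2 + 4 * a)) := by
  have heron := quadraticNorm_heron x y z
  rw [hxz, hyz] at heron
  have leg_pos := quadraticNorm_pos hΔ (sub_ne_zero.mpr hxy)
  refine isSquare_of_sq_eq_mul_sq (x := 2 * (x - y).norm)
    (y := (x - y).re * (x - z).im - (x - z).re * (x - y).im) (fun hdet => ?_)
    (by linear_combination heron)
  rw [hdet] at heron
  linarith [mul_pos leg_pos leg_pos]

variable {A B : R} {s : Finset (QuadraticAlgebra R a b)}
  (hΔ : b ^ 2 + 4 * a < 0) (h5 : ¬IsSquare (5 : R)) (hsq : ¬IsSquare (-(b ^ 2 + 4 * a)))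
include hΔ h5 hsq

/- If `w z` has length `x y`, the four points form a square; if it has length `x z`, they are four
vertices of a regular pentagon. -/
lemma quadraticNorm_sub_ne_of_equilateral_path (hxy : x ≠ y) (hxz : x ≠ z)
    (hwx : (w - x).norm = (x - y).norm) (hyz : (y - z).norm = (x - y).norm)
    (hwy : (w - y).norm = (x - z).norm) :
    (w - z).norm ≠ (x - y).norm ∧ (w - z).norm ≠ (x - z).norm := by
  have side_pos := quadraticNorm_pos hΔ (sub_ne_zero.mpr hxy)
  have diagonal_pos := quadraticNorm_pos hΔ (sub_ne_zero.mpr hxz)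
  have path := quadraticNorm_equilateral_path hwx rfl hyz hwy rfl
  constructor <;> intro hwz <;> rw [hwz] at path
  · have diagonal : (x - z).norm = 2 * (x - y).norm := by
      have : (x - z).norm ^ 2 * ((x - z).norm - 2 * (x - y).norm) = 0 := by linarith
      linarith [(mul_eq_zero.mp this).resolve_left (by positivity)]
    rw [quadraticNorm_sub_comm x y] at hyz diagonal
    exact hsq (isSquare_of_isosceles_right hΔ hxy.symm hyz diagonal)
  · have golden : ((x - z).norm - (x - y).norm) ^ 2 = (x - y).norm * (x - z).norm :=
      sub_eq_zero.mp ((mul_eq_zero.mp path).resolve_left (by linarith))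
    exact h5 (isSquare_of_sq_eq_mul_sq (x := 2 * (x - z).norm - 3 * (x - y).norm) side_pos.ne'
      (by linear_combination 4 * golden))

variable (h3 : ¬IsSquare (-3 * (b ^ 2 + 4 * a))) (hs : sqDistances s ⊆ {A, B})
include h3 hs

lemma not_equilateral_path_of_sqDistances_subset_pair (hw : w ∈ s) (hx : x ∈ s) (hy : y ∈ s)
    (hz : z ∈ s) (hwy : w ≠ y) (hxy : x ≠ y) (hwz : w ≠ z) (hxz : x ≠ z)
    (hwx : (w - x).norm = (x - y).norm) : (y - z).norm ≠ (x - y).norm := by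
  intro hyz
  have hwy_ne : (w - y).norm ≠ (x - y).norm := fun h =>
    h3 (isSquare_of_equilateral hΔ hxy (by rwa [quadraticNorm_sub_comm x w])
      (by rwa [quadraticNorm_sub_comm y w]))
  have hxz_ne : (x - z).norm ≠ (x - y).norm := fun h => h3 (isSquare_of_equilateral hΔ hxy h hyz)
  have hwz_ne := quadraticNorm_sub_ne_of_equilateral_path hΔ h5 hsq hxy hxz hwx hyz
  grind [quadraticNorm_sub_eq_or_eq hs]

/- If `w x` and `x y` have length `α`, every other distance from `w` or `y` must be `β`, so `w y z`
is equilateral. -/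
lemma not_isosceles_of_sqDistances_subset_pair (hw : w ∈ s) (hx : x ∈ s) (hy : y ∈ s)
    (hz : z ∈ s) (hwx : w ≠ x) (hwy : w ≠ y) (hxy : x ≠ y) (hwz : w ≠ z) (hxz : x ≠ z)
    (hyz : y ≠ z) : (w - x).norm ≠ (x - y).norm := by
  intro h
  have no_path_wxyz := not_equilateral_path_of_sqDistances_subset_pair hΔ h5 hsq h3 hs
    hw hx hy hz hwy hxy hwz hxz h
  have no_path_yxwz := not_equilateral_path_of_sqDistances_subset_pair hΔ h5 hsq h3 hs
    hy hx hw hz hwy.symm hwx.symm hyz hxz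
  have no_equilateral_wxy : (w - y).norm ≠ (x - y).norm := fun h' =>
    h3 (isSquare_of_equilateral hΔ hxy (by rwa [quadraticNorm_sub_comm x w])
      (by rwa [quadraticNorm_sub_comm y w]))
  have no_equilateral_wyz := isSquare_of_equilateral hΔ hwy (z := z)
  grind [quadraticNorm_sub_comm, quadraticNorm_sub_eq_or_eq hs]

omit hs in
theorem three_le_card_sqDistances (hcard : #s = 4) : 3 ≤ #(sqDistances s) := by
  by_contra! hlt
  obtain ⟨pair, hsub, hpair⟩ := Infinite.exists_superset_card_eq (sqDistances s) 2 (by omega)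
  obtain ⟨A, B, -, rfl⟩ := card_eq_two.mp hpair
  obtain ⟨w, x, y, z, hwx, hwy, hwz, hxy, hxz, hyz, hs⟩ := card_eq_four.mp hcard
  have hw : w ∈ s := by simp [hs]
  have hx : x ∈ s := by simp [hs]
  have hy : y ∈ s := by simp [hs]
  have hz : z ∈ s := by simp [hs]
  have hwx_ne_xy := not_isosceles_of_sqDistances_subset_pair hΔ h5 hsq h3 hsub hw hx hy hz
    hwx hwy hxy hwz hxz hyz
  have hyx_ne_xz := not_isosceles_of_sqDistances_subset_pair hΔ h5 hsq h3 hsub hy hx hz hw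
    hxy.symm hyz hxz hwy.symm hwx.symm hwz.symm
  have hzx_ne_xw := not_isosceles_of_sqDistances_subset_pair hΔ h5 hsq h3 hsub hz hx hw hy
    hxz.symm hwz.symm hwx.symm hyz.symm hxy hwy
  -- The three distances from `x` are pairwise distinct, but take only two values.
  grind [quadraticNorm_sub_comm, quadraticNorm_sub_eq_or_eq hsub]

end NegativeDiscriminant

section Embedding

/-- The embedding of an imaginary quadratic order `ℤ[ω]`, `ω ^ 2 = a + b * ω`, in the plane by
real and imaginary parts: `ω ↦ (b / 2, √(-(b ^ 2 + 4 * a)) / 2)`. -/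
noncomputable def toPlane {a b : ℤ} : QuadraticAlgebra ℤ a b →+ Plane where
  toFun z := (z.re : ℝ) • !₂[(1 : ℝ), 0] +
    (z.im : ℝ) • !₂[(b / 2 : ℝ), √(-(b ^ 2 + 4 * a : ℤ)) / 2]
  map_zero' := by simp
  map_add' y z := by
    push_cast [QuadraticAlgebra.re_add, QuadraticAlgebra.im_add]
    module

lemma latticeSeven_eq_range_toPlane :
    latticeSeven = Set.range (toPlane : QuadraticAlgebra ℤ (-2) 1 →+ Plane) := by
  ext u
  constructor
  · rintro ⟨m, k, rfl⟩
    exact ⟨⟨m, k⟩, by simp [toPlane]⟩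
  · rintro ⟨z, rfl⟩
    exact ⟨z.re, z.im, by simp [toPlane]⟩

variable {a b : ℤ} (hΔ : b ^ 2 + 4 * a < 0)
include hΔ

lemma norm_toPlane_sq (z : QuadraticAlgebra ℤ a b) : ‖toPlane z‖ ^ 2 = z.norm := by
  have hsqrt : √(-(b ^ 2 + 4 * a : ℤ)) ^ 2 = (-(b ^ 2 + 4 * a : ℤ)) :=
    Real.sq_sqrt (by exact_mod_cast (neg_pos.mpr hΔ).le)
  rw [EuclideanSpace.norm_sq_eq, QuadraticAlgebra.norm_def]
  simp only [toPlane, AddMonoidHom.coe_mk, ZeroHom.coe_mk, PiLp.add_apply, PiLp.smul_apply,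
    smul_eq_mul, Real.norm_eq_abs, sq_abs, Fin.sum_univ_two, Fin.isValue, Matrix.cons_val_zero,
    Matrix.cons_val_one, Matrix.cons_val_fin_one]
  push_cast at hsqrt ⊢
  linear_combination (z.im : ℝ) ^ 2 / 4 * hsqrt

lemma norm_toPlane (z : QuadraticAlgebra ℤ a b) : ‖toPlane z‖ = √z.norm := by
  rw [← norm_toPlane_sq hΔ, Real.sqrt_sq (norm_nonneg _)]

lemma quadraticNorm_nonneg (z : QuadraticAlgebra ℤ a b) : 0 ≤ z.norm := by
  have := norm_toPlane_sq hΔ z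
  exact_mod_cast this ▸ sq_nonneg ‖toPlane z‖

lemma norm_toPlane_le_norm_toPlane_iff {y z : QuadraticAlgebra ℤ a b} :
    ‖toPlane y‖ ≤ ‖toPlane z‖ ↔ y.norm ≤ z.norm := by
  rw [norm_toPlane hΔ, norm_toPlane hΔ, Real.sqrt_le_sqrt_iff
    (by exact_mod_cast quadraticNorm_nonneg hΔ z), Int.cast_le]

lemma toPlane_injective : Function.Injective (toPlane (a := a) (b := b)) := by
  refine (injective_iff_map_eq_zero _).mpr fun z hz => ?_
  by_contra hne
  have := norm_toPlane_sq hΔ z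
  rw [hz, norm_zero, zero_pow two_ne_zero] at this
  exact (quadraticNorm_pos hΔ hne).ne (by exact_mod_cast this)

lemma distances_image_toPlane (s : Finset (QuadraticAlgebra ℤ a b)) :
    distances (toPlane '' (s : Set (QuadraticAlgebra ℤ a b))) =
      (fun r : ℤ => √r) '' (sqDistances s : Set ℤ) := by
  ext d
  simp [distances, sqDistances, dist_eq_norm, ← map_sub, norm_toPlane hΔ,
    (toPlane_injective hΔ).ne_iff, and_assoc]

lemma ncard_distances_image_toPlane (s : Finset (QuadraticAlgebra ℤ a b)) :
    (distances (toPlane '' (s : Set (QuadraticAlgebra ℤ a b)))).ncard = #(sqDistances s) := by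
  rw [distances_image_toPlane hΔ, Set.InjOn.ncard_image, Set.ncard_coe_finset]
  have nonneg : ∀ r ∈ sqDistances s, (0 : ℝ) ≤ r := fun r hr => by
    exact_mod_cast (pos_of_mem_sqDistances hΔ hr).le
  exact fun r hr t ht h => by exact_mod_cast (Real.sqrt_inj (nonneg r hr) (nonneg t ht)).mp h

lemma fourPointsThreeDistances_range_toPlane (h5 : ¬IsSquare (5 : ℤ))
    (hsq : ¬IsSquare (-(b ^ 2 + 4 * a))) (h3 : ¬IsSquare (-3 * (b ^ 2 + 4 * a))) :
    FourPointsThreeDistances (Set.range (toPlane : QuadraticAlgebra ℤ a b →+ Plane)) := by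
  intro T hT hcard
  classical
  obtain ⟨s, -, rfl⟩ := subset_set_image_iff.mp (Set.image_univ ▸ hT)
  rw [card_image_of_injective _ (toPlane_injective hΔ)] at hcard
  simpa [ncard_distances_image_toPlane hΔ] using three_le_card_sqDistances hΔ h5 hsq h3 hcard

end Embedding

lemma FourPointsThreeDistances.mono {S T : Set Plane} (hT : FourPointsThreeDistances T)
    (hST : S ⊆ T) : FourPointsThreeDistances S :=
  fun U hU hcard => hT U (hU.trans hST) hcard

lemma fourPointsThreeDistances_latticeSeven : FourPointsThreeDistances latticeSeven := by
  rw [latticeSeven_eq_range_toPlane]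
  apply fourPointsThreeDistances_range_toPlane <;> norm_num

section Nearest

lemma exists_finset_card_eq_forall_le {α β : Type*} [Infinite α] [LinearOrder β] [WellFoundedLT β]
    (f : α → β) (n : ℕ) : ∃ s : Finset α, #s = n ∧ ∀ p ∈ s, ∀ q ∉ s, f p ≤ f q := by
  classical
  induction n with
  | zero => exact ⟨∅, by simp⟩
  | succ n ih =>
    obtain ⟨s, hcard, hs⟩ := ih
    obtain ⟨m, hm : m ∉ s, hmin⟩ : ∃ m ∈ {q | q ∉ s}, ∀ q ∈ {q | q ∉ s}, ¬f q < f m :=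
      (InvImage.wf f wellFounded_lt).has_min _ (Infinite.exists_notMem_finset s)
    refine ⟨insert m s, by rw [card_insert_of_notMem hm, hcard], fun p hp q hq => ?_⟩
    rw [mem_insert, not_or] at hq
    obtain rfl | hp := mem_insert.mp hp
    · exact not_lt.mp (hmin q hq.2)
    · exact hs p hp q hq.2

variable {a b : ℤ} {s : Finset (QuadraticAlgebra ℤ a b)}

/- Among the more than `#s` points of a box of side about `√#s` one lies outside `s`. -/
lemma quadraticNorm_le_mul_card (hs : ∀ p ∈ s, ∀ q ∉ s, p.norm ≤ q.norm)
    {p : QuadraticAlgebra ℤ a b} (hp : p ∈ s) : p.norm ≤ (1 + |a| + |b|) * #s := by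
  set m := Nat.sqrt #s
  have hm : (m : ℤ) ^ 2 ≤ #s := by exact_mod_cast Nat.sqrt_le' _
  let box : Finset (QuadraticAlgebra ℤ a b) :=
    ((range (m + 1) ×ˢ range (m + 1)).image fun x => ⟨x.1, x.2⟩)
  have hbox : #s < #box := by
    rw [card_image_of_injective _ fun x y h => by simpa [Prod.ext_iff] using h, card_product,
      card_range]
    exact Nat.lt_succ_sqrt _
  obtain ⟨q, hq, hqs⟩ := exists_mem_notMem_of_card_lt_card hbox
  obtain ⟨⟨i, j⟩, hij, rfl⟩ := mem_image.mp hq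
  simp only [mem_product, mem_range, Nat.lt_succ_iff] at hij
  have hi : (i : ℤ) ≤ m := by exact_mod_cast hij.1
  have hj : (j : ℤ) ≤ m := by exact_mod_cast hij.2
  calc p.norm ≤ (i : ℤ) * i + b * i * j - a * j * j := hs p hp _ hqs
    _ ≤ (i : ℤ) * i + |b| * i * j + |a| * j * j := by
        rw [sub_eq_add_neg, ← neg_mul, ← neg_mul]
        gcongr
        exacts [le_abs_self b, neg_le_abs a]
    _ ≤ (m : ℤ) * m + |b| * m * m + |a| * m * m := by gcongr
    _ = (1 + |a| + |b|) * m ^ 2 := by ring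
    _ ≤ (1 + |a| + |b|) * #s := by gcongr

lemma mem_sqDistances_le_mul_card (hΔ : b ^ 2 + 4 * a < 0)
    (hs : ∀ p ∈ s, ∀ q ∉ s, p.norm ≤ q.norm) {r : ℤ} (hr : r ∈ sqDistances s) :
    r ≤ 4 * (1 + |a| + |b|) * #s := by
  obtain ⟨⟨p, q⟩, hpq, rfl⟩ := mem_image.mp hr
  obtain ⟨hp, hq, -⟩ := mem_offDiag.mp hpq
  linarith [quadraticNorm_add_add_quadraticNorm_sub p q, quadraticNorm_nonneg hΔ (p + q),
    quadraticNorm_le_mul_card hs hp, quadraticNorm_le_mul_card hs hq]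

lemma isNearestLatticePoints_iff {n : ℕ} {P : Finset Plane} :
    IsNearestLatticePoints n P ↔ ∃ s : Finset (QuadraticAlgebra ℤ (-2) 1),
      toPlane '' (s : Set (QuadraticAlgebra ℤ (-2) 1)) = P ∧ #s = n ∧
        ∀ p ∈ s, ∀ q ∉ s, p.norm ≤ q.norm := by
  classical
  have hΔ : (1 : ℤ) ^ 2 + 4 * -2 < 0 := by norm_num
  have hinj := toPlane_injective hΔ
  rw [IsNearestLatticePoints, latticeSeven_eq_range_toPlane]
  constructor
  · rintro ⟨hsub, rfl, hP⟩
    obtain ⟨s, -, rfl⟩ := subset_set_image_iff.mp (Set.image_univ ▸ hsub)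
    refine ⟨s, coe_image.symm, (card_image_of_injective s hinj).symm, fun p hp q hq => ?_⟩
    rw [← norm_toPlane_le_norm_toPlane_iff hΔ]
    exact hP _ (mem_image_of_mem _ hp) _ ⟨q, rfl⟩ (by rwa [hinj.mem_finset_image])
  · rintro ⟨s, hsP, rfl, hs⟩
    obtain rfl : s.image toPlane = P := coe_injective (coe_image.trans hsP)
    refine ⟨by simp, card_image_of_injective s hinj, ?_⟩
    simp only [forall_mem_image, Set.forall_mem_range, hinj.mem_finset_image,
      norm_toPlane_le_norm_toPlane_iff hΔ]
    exact hs

lemma exists_isNearestLatticePoints (n : ℕ) : ∃ P : Finset Plane, IsNearestLatticePoints n P := by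
  classical
  obtain ⟨s, hcard, hs⟩ :=
    exists_finset_card_eq_forall_le (fun z : QuadraticAlgebra ℤ (-2) 1 => z.norm.toNat) n
  have hΔ : (1 : ℤ) ^ 2 + 4 * -2 < 0 := by norm_num
  exact ⟨s.image toPlane, isNearestLatticePoints_iff.mpr ⟨s, coe_image.symm, hcard,
    fun p hp q hq => (Int.toNat_le.mp (hs p hp q hq)).trans_eq
      (Int.toNat_of_nonneg (quadraticNorm_nonneg hΔ q))⟩⟩

end Nearest

section Density

open Classical in
/-- The elements `n` of `A` with `0 < n ≤ N`. -/
noncomputable def upTo (A : Set ℕ) (N : ℕ) : Finset ℕ := {n ∈ Ioc 0 N | n ∈ A}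

/-- The sum of `1 / n` over the elements `n` of `A` with `0 < n ≤ N`. -/
noncomputable def reciprocalSum (A : Set ℕ) (N : ℕ) : ℝ := ∑ n ∈ upTo A N, 1 / (n : ℝ)

variable {A : Set ℕ} {M N n : ℕ}

lemma mem_upTo : n ∈ upTo A N ↔ (0 < n ∧ n ≤ N) ∧ n ∈ A := by
  simp only [upTo, mem_filter, mem_Ioc]

lemma sum_upTo (f : ℕ → ℝ) : ∑ n ∈ upTo A N, f n = ∑ n ∈ Ioc 0 N, A.indicator f n := by
  classical
  rw [upTo, sum_filter]
  rfl

lemma reciprocalSum_nonneg (A : Set ℕ) (N : ℕ) : 0 ≤ reciprocalSum A N :=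
  sum_nonneg fun _ _ => by positivity

lemma reciprocalSum_mono (A : Set ℕ) (h : M ≤ N) : reciprocalSum A M ≤ reciprocalSum A N := by
  refine sum_le_sum_of_subset_of_nonneg (fun n hn => ?_) fun _ _ _ => by positivity
  rw [mem_upTo] at hn ⊢
  exact ⟨⟨hn.1.1, hn.1.2.trans h⟩, hn.2⟩

lemma card_upTo_le_mul_reciprocalSum {x : ℝ} (hx : 0 ≤ x) :
    (#(upTo A ⌊x⌋₊) : ℝ) ≤ x * reciprocalSum A ⌊x⌋₊ := by
  rw [card_eq_sum_ones, reciprocalSum, mul_sum]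
  push_cast
  refine sum_le_sum fun n hn => ?_
  obtain ⟨⟨hn0, hnx⟩, -⟩ := mem_upTo.mp hn
  rw [mul_one_div, one_le_div (by positivity)]
  exact (Nat.le_floor_iff hx).mp hnx

open ArithmeticFunction (vonMangoldt) in
/- `log n` is the sum of `Λ` over the divisors of `n`; writing `n = m * d` with `m ∈ A`, the sum of
`Λ d` over `d ≤ x / m` is Chebyshev's `ψ (x / m) = O(x / m)`. -/
lemma sum_log_upTo_le (hA : ∀ m n, m ∣ n → n ∈ A → m ∈ A) {x : ℝ} (hx : 0 ≤ x) :
    ∑ n ∈ upTo A ⌊x⌋₊, Real.log n ≤ (Real.log 4 + 4) * x * reciprocalSum A ⌊x⌋₊ := by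
  classical
  let ind : ArithmeticFunction ℝ := ⟨(A \ {0}).indicator 1, by simp⟩
  have ind_nonneg : ∀ n, 0 ≤ ind n := Set.indicator_nonneg fun _ _ => zero_le_one
  have ind_eq_one : ∀ n, n ≠ 0 → n ∈ A → ind n = 1 := fun n hn0 hn =>
    Set.indicator_of_mem (show n ∈ A \ {0} from ⟨hn, hn0⟩) 1
  have ind_eq_zero : ∀ n, n ∉ A → ind n = 0 := fun n hn =>
    Set.indicator_of_notMem (fun h : n ∈ A \ {0} => hn h.1) 1
  calc ∑ n ∈ upTo A ⌊x⌋₊, Real.log n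
      ≤ ∑ n ∈ upTo A ⌊x⌋₊, (ind * vonMangoldt) n := by
        refine sum_le_sum fun n hn => ?_
        rw [← ArithmeticFunction.vonMangoldt_sum, ArithmeticFunction.mul_apply,
          ← Nat.sum_divisorsAntidiagonal' (f := fun _ d => vonMangoldt d)]
        refine sum_le_sum fun x hx => ?_
        obtain ⟨hxn, hn0⟩ := Nat.mem_divisorsAntidiagonal.mp hx
        have hx1 : x.1 ∣ n := ⟨x.2, hxn.symm⟩
        rw [ind_eq_one _ (ne_zero_of_dvd_ne_zero hn0 hx1) (hA _ _ hx1 (mem_upTo.mp hn).2), one_mul]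
    _ ≤ ∑ n ∈ Ioc 0 ⌊x⌋₊, (ind * vonMangoldt) n := by
        refine sum_le_sum_of_subset_of_nonneg (filter_subset _ _) fun n _ _ => ?_
        rw [ArithmeticFunction.mul_apply]
        exact sum_nonneg fun x _ => mul_nonneg (ind_nonneg _) ArithmeticFunction.vonMangoldt_nonneg
    _ = ∑ n ∈ Ioc 0 ⌊x⌋₊, ind n * Chebyshev.psi (x / n) := by
        rw [ArithmeticFunction.sum_Ioc_mul_eq_sum_sum]
        simp only [Chebyshev.psi, Nat.floor_div_natCast]
    _ ≤ ∑ n ∈ Ioc 0 ⌊x⌋₊, ind n * ((Real.log 4 + 4) * (x / n)) := by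
        gcongr with n _
        · exact ind_nonneg n
        · exact Chebyshev.psi_le_const_mul_self (by positivity)
    _ = (Real.log 4 + 4) * x * reciprocalSum A ⌊x⌋₊ := by
        rw [reciprocalSum, sum_upTo, mul_sum]
        refine sum_congr rfl fun n hn => ?_
        have hn0 := (mem_Ioc.mp hn).1.ne'
        by_cases hnA : n ∈ A
        · rw [ind_eq_one n hn0 hnA, Set.indicator_of_mem hnA]; ring
        · rw [ind_eq_zero n hnA, Set.indicator_of_notMem hnA, zero_mul, mul_zero]

lemma log_mul_card_upTo_le (hA : ∀ m n, m ∣ n → n ∈ A → m ∈ A) {x : ℝ} (hx : 0 ≤ x) :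
    Real.log x * #(upTo A ⌊x⌋₊) ≤ (Real.log 4 + 5) * x * reciprocalSum A ⌊x⌋₊ := by
  have log_le : ∀ n ∈ upTo A ⌊x⌋₊, Real.log x ≤ Real.log n + x * (1 / n) := by
    intro n hn
    obtain ⟨⟨hn0, hnx⟩, -⟩ := mem_upTo.mp hn
    have hx0 : x ≠ 0 := by rintro rfl; simp at hnx; omega
    have := Real.log_le_self (show 0 ≤ x / n by positivity)
    rw [Real.log_div hx0 (by positivity)] at this
    rw [mul_one_div]
    linarith
  calc Real.log x * #(upTo A ⌊x⌋₊) = ∑ _n ∈ upTo A ⌊x⌋₊, Real.log x := by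
        rw [sum_const, nsmul_eq_mul, mul_comm]
    _ ≤ ∑ n ∈ upTo A ⌊x⌋₊, Real.log n + x * reciprocalSum A ⌊x⌋₊ := by
        rw [reciprocalSum, mul_sum, ← sum_add_distrib]
        exact sum_le_sum log_le
    _ ≤ (Real.log 4 + 5) * x * reciprocalSum A ⌊x⌋₊ := by linarith [sum_log_upTo_le hA hx]

lemma summable_const_add_log_div_sq (c : ℝ) :
    Summable fun d : ℕ => (c + 2 * Real.log d) / (d : ℝ) ^ 2 := by
  have hlog : Summable fun d : ℕ => Real.log d / (d : ℝ) ^ 2 := by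
    refine .of_nonneg_of_le (fun d => by positivity) (fun d => ?_)
      (((Real.summable_nat_rpow (p := -(3 / 2))).mpr (by norm_num)).mul_left 2)
    rcases Nat.eq_zero_or_pos d with rfl | hd
    · simp
    have hd' : (0 : ℝ) < d := by positivity
    rw [div_le_iff₀ (by positivity), mul_assoc, ← Real.rpow_natCast, ← Real.rpow_add hd']
    have := Real.log_le_rpow_div hd'.le (ε := 1 / 2) (by norm_num)
    norm_num at this ⊢
    linarith
  simpa only [add_div, mul_div_assoc, mul_one_div] using
    ((Real.summable_one_div_nat_pow.mpr one_lt_two).mul_left c).add (hlog.mul_left 2)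

lemma sum_card_upTo_div_sq_mul_log_le (hA : ∀ m n, m ∣ n → n ∈ A → m ∈ A) (N : ℕ) :
    (∑ d ∈ Ioc 0 N, (#(upTo A (N / d ^ 2)) : ℝ)) * Real.log N ≤
      (∑' d : ℕ, (Real.log 4 + 5 + 2 * Real.log d) / (d : ℝ) ^ 2) * N * reciprocalSum A N := by
  have term_le : ∀ d ∈ Ioc 0 N, (#(upTo A (N / d ^ 2)) : ℝ) * Real.log N ≤
      (Real.log 4 + 5 + 2 * Real.log d) / (d : ℝ) ^ 2 * (N * reciprocalSum A N) := by
    intro d hd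
    obtain ⟨hd0, hdN⟩ := mem_Ioc.mp hd
    have hN : (N : ℝ) ≠ 0 := by have := hd0.trans_le hdN; positivity
    set x : ℝ := N / (d : ℝ) ^ 2
    have hx : 0 ≤ x := by positivity
    have hfloor : N / d ^ 2 = ⌊x⌋₊ := by
      rw [← Nat.floor_div_eq_div (K := ℝ), Nat.cast_pow]
    have hlog : Real.log N = Real.log x + 2 * Real.log d := by
      rw [Real.log_div hN (by positivity), Real.log_pow]
      push_cast
      ring
    have hmono : reciprocalSum A ⌊x⌋₊ ≤ reciprocalSum A N :=
      hfloor ▸ reciprocalSum_mono A (Nat.div_le_self _ _)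
    rw [hfloor, hlog]
    calc (#(upTo A ⌊x⌋₊) : ℝ) * (Real.log x + 2 * Real.log d)
        = Real.log x * #(upTo A ⌊x⌋₊) + 2 * Real.log d * #(upTo A ⌊x⌋₊) := by ring
      _ ≤ (Real.log 4 + 5) * x * reciprocalSum A ⌊x⌋₊ +
            2 * Real.log d * (x * reciprocalSum A ⌊x⌋₊) := by
          refine add_le_add (log_mul_card_upTo_le hA hx) ?_
          exact mul_le_mul_of_nonneg_left (card_upTo_le_mul_reciprocalSum hx) (by positivity)
      _ = (Real.log 4 + 5 + 2 * Real.log d) * x * reciprocalSum A ⌊x⌋₊ := by ring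
      _ ≤ (Real.log 4 + 5 + 2 * Real.log d) * x * reciprocalSum A N := by gcongr
      _ = _ := by ring
  rw [sum_mul, mul_assoc]
  refine (sum_le_sum term_le).trans ?_
  rw [← sum_mul]
  gcongr
  · have := reciprocalSum_nonneg A N; positivity
  · exact (summable_const_add_log_div_sq _).sum_le_tsum _ fun d _ => by positivity

end Density

section PartialSums

lemma sum_div_le_of_forall_sum_le {f : ℕ → ℝ} {M : ℝ} (hf : ∀ n, ∑ i ∈ Ioc 0 n, f i ≤ M) (n : ℕ) :
    ∑ i ∈ Ioc 0 n, f i / i ≤ M := by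
  /- Partial summation, with the boundary term kept on the right so that the induction closes. -/
  have key : ∑ i ∈ Ioc 0 n, f i / i ≤ M - (M - ∑ i ∈ Ioc 0 n, f i) / (n + 1) := by
    induction n with
    | zero => simp
    | succ n ih =>
      have weight_le : (M - ∑ i ∈ Ioc 0 (n + 1), f i) / ((n + 1 : ℕ) + 1) ≤
          (M - ∑ i ∈ Ioc 0 (n + 1), f i) / (n + 1) := by
        refine div_le_div_of_nonneg_left (sub_nonneg.mpr (hf _)) (by positivity) ?_
        push_cast
        linarith
      refine le_trans ?_ (sub_le_sub_left weight_le M)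
      rw [sum_Ioc_succ_top (by omega), sum_Ioc_succ_top (by omega)]
      calc _ ≤ M - (M - ∑ i ∈ Ioc 0 n, f i) / (n + 1) + f (n + 1) / (n + 1 : ℕ) := by gcongr
        _ = _ := by push_cast; ring
  have := div_nonneg (sub_nonneg.mpr (hf n)) (show (0 : ℝ) ≤ n + 1 by positivity)
  linarith

lemma sum_range_zmod {q : ℕ} [NeZero q] {M : Type*} [AddCommMonoid M] (f : ZMod q → M) :
    ∑ i ∈ range q, f i = ∑ x, f x :=
  sum_nbij' (fun i => (i : ZMod q)) ZMod.val (fun _ _ => mem_univ _)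
    (fun x _ => mem_range.mpr x.val_lt) (fun _ hi => ZMod.val_cast_of_lt (mem_range.mp hi))
    (fun x _ => x.natCast_zmod_val) fun _ _ => rfl

lemma sum_range_le_of_sum_zmod_eq_zero {q : ℕ} [NeZero q] {f : ZMod q → ℤ} (hf : ∑ x, f x = 0)
    (hf1 : ∀ x, f x ≤ 1) (n : ℕ) : ∑ i ∈ range n, f i ≤ q := by
  have periodic : Function.Periodic (fun n => ∑ i ∈ range n, f i) q := fun n => by
    simp only [add_comm n q, sum_range_add, Nat.cast_add, CharP.cast_eq_zero, zero_add,
      sum_range_zmod, hf]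
  calc ∑ i ∈ range n, f i = ∑ i ∈ range (n % q), f i := (periodic.map_mod_nat n).symm
    _ ≤ ∑ i ∈ range (n % q), 1 := sum_le_sum fun i _ => hf1 i
    _ ≤ q := by
        rw [sum_const, card_range, nsmul_one]
        exact_mod_cast (Nat.mod_lt n (NeZero.pos q)).le

end PartialSums

section QuadraticCharacter

variable {q : ℕ} {χ : DirichletCharacter ℤ q}

lemma sum_Ioc_le_of_isQuadratic [NeZero q] (hχ : χ.IsQuadratic) (hχ1 : χ ≠ 1) (n : ℕ) :
    ∑ i ∈ Ioc 0 n, χ i ≤ q := by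
  have shift : ∑ i ∈ Ioc 0 n, χ i = ∑ i ∈ range n, χ (i + 1 : ZMod q) := by
    rw [range_eq_Ico, ← Ico_add_one_add_one_eq_Ioc]
    exact_mod_cast (sum_Ico_add' (fun i : ℕ => χ i) 0 n 1).symm
  rw [shift]
  refine sum_range_le_of_sum_zmod_eq_zero (f := fun x => χ (x + 1)) ?_ (fun x => ?_) n
  · exact (Equiv.sum_comp (Equiv.addRight (1 : ZMod q)) χ).trans
      (MulChar.sum_eq_zero_of_ne_one hχ1)
  · rcases hχ (x + 1) with h | h | h <;> simp only [h] <;> decide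

lemma sum_divisors_nonneg_of_isQuadratic (hχ : χ.IsQuadratic) (n : ℕ) :
    0 ≤ ∑ d ∈ n.divisors, χ d := by
  have hχ2 : χ.ringHomComp (Int.castRingHom ℂ) ^ 2 = 1 :=
    MulChar.isQuadratic_iff_sq_eq_one.mp (hχ.comp _)
  have zetaMul_eq : DirichletCharacter.zetaMul (χ.ringHomComp (Int.castRingHom ℂ)) n =
      ((∑ d ∈ n.divisors, χ d : ℤ) : ℂ) := by
    rw [DirichletCharacter.zetaMul, ArithmeticFunction.coe_zeta_mul_apply, Int.cast_sum]
    refine sum_congr rfl fun d hd => ?_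
    simp [toArithmeticFunction, (Nat.pos_of_mem_divisors hd).ne']
  have re_nonneg := (Complex.le_def.mp (DirichletCharacter.zetaMul_nonneg hχ2 n)).1
  rw [zetaMul_eq, Complex.intCast_re, Complex.zero_re] at re_nonneg
  exact_mod_cast re_nonneg

/-- The numbers all of whose prime divisors `p` split, in the sense that `χ p = 1`. -/
def splitNumbers (χ : DirichletCharacter ℤ q) : Set ℕ := {n | ∀ p : ℕ, p.Prime → p ∣ n → χ p = 1}

/-- The numbers which every prime `p` with `χ p = -1` (an inert prime) divides to an even power. -/
def evenInertNumbers (χ : DirichletCharacter ℤ q) : Set ℕ :=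
  {n | ∀ p : ℕ, p.Prime → χ p = -1 → Even (n.factorization p)}

lemma mem_splitNumbers_of_dvd {m n : ℕ} (hmn : m ∣ n) (hn : n ∈ splitNumbers χ) :
    m ∈ splitNumbers χ :=
  fun p hp hpm => hn p hp (hpm.trans hmn)

lemma mul_mem_splitNumbers {m n : ℕ} (hm : m ∈ splitNumbers χ) (hn : n ∈ splitNumbers χ) :
    m * n ∈ splitNumbers χ :=
  fun p hp hpmn => (hp.dvd_mul.mp hpmn).elim (hm p hp) (hn p hp)

lemma apply_eq_one_of_mem_splitNumbers {n : ℕ} (hn0 : n ≠ 0) (hn : n ∈ splitNumbers χ) :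
    χ n = 1 := by
  induction n using Nat.recOnMul with
  | zero => exact absurd rfl hn0
  | one => simp
  | prime p hp => exact hn p hp dvd_rfl
  | mul a b iha ihb =>
    rw [Nat.cast_mul, map_mul,
      iha (left_ne_zero_of_mul hn0) (mem_splitNumbers_of_dvd (dvd_mul_right a b) hn),
      ihb (right_ne_zero_of_mul hn0) (mem_splitNumbers_of_dvd (dvd_mul_left b a) hn), mul_one]

/- If `n` lies in `splitNumbers χ`, so do its divisors and both sides agree; otherwise the left side
vanishes and the right side is the sum of `χ` over the divisors of `n`, divided by `n`. -/
lemma sum_divisorsAntidiagonal_indicator_splitNumbers_le (hχ : χ.IsQuadratic) (n : ℕ) :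
    ∑ x ∈ n.divisorsAntidiagonal, (splitNumbers χ).indicator (fun m => 1 / (m : ℝ)) x.1 *
        (splitNumbers χ).indicator (fun m => 1 / (m : ℝ)) x.2 ≤
      ∑ x ∈ n.divisorsAntidiagonal, 1 / (x.1 : ℝ) * ((χ x.2 : ℝ) / x.2) := by
  by_cases hn : n ∈ splitNumbers χ
  · refine (sum_congr rfl fun x hx => ?_).le
    obtain ⟨hxn, hn0⟩ := Nat.mem_divisorsAntidiagonal.mp hx
    have hx1 : x.1 ∈ splitNumbers χ := mem_splitNumbers_of_dvd ⟨x.2, hxn.symm⟩ hn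
    have hx2 : x.2 ∈ splitNumbers χ := mem_splitNumbers_of_dvd ⟨x.1, by rw [← hxn, mul_comm]⟩ hn
    rw [Set.indicator_of_mem hx1, Set.indicator_of_mem hx2,
      apply_eq_one_of_mem_splitNumbers (right_ne_zero_of_mul (hxn ▸ hn0)) hx2, Int.cast_one]
  · have left_eq_zero : ∀ x ∈ n.divisorsAntidiagonal,
        (splitNumbers χ).indicator (fun m => 1 / (m : ℝ)) x.1 *
          (splitNumbers χ).indicator (fun m => 1 / (m : ℝ)) x.2 = 0 := by
      intro x hx
      by_contra h
      refine hn ((Nat.mem_divisorsAntidiagonal.mp hx).1 ▸ mul_mem_splitNumbers ?_ ?_)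
      · exact Set.mem_of_indicator_ne_zero (left_ne_zero_of_mul h)
      · exact Set.mem_of_indicator_ne_zero (right_ne_zero_of_mul h)
    have right_eq : ∑ x ∈ n.divisorsAntidiagonal, 1 / (x.1 : ℝ) * ((χ x.2 : ℝ) / x.2) =
        (∑ d ∈ n.divisors, χ d : ℤ) / (n : ℝ) := by
      rw [← Nat.sum_divisorsAntidiagonal' (f := fun _ d => χ d), Int.cast_sum, sum_div]
      refine sum_congr rfl fun x hx => ?_
      rw [← (Nat.mem_divisorsAntidiagonal.mp hx).1, Nat.cast_mul, div_mul_div_comm, one_mul]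
    rw [sum_eq_zero left_eq_zero, right_eq]
    exact div_nonneg (by exact_mod_cast sum_divisors_nonneg_of_isQuadratic hχ n) n.cast_nonneg

lemma sq_sum_Ioc_le_sum_Ioc_mul (f : ArithmeticFunction ℝ) (hf : ∀ n, 0 ≤ f n) (N : ℕ) :
    (∑ n ∈ Ioc 0 N, f n) ^ 2 ≤ ∑ n ∈ Ioc 0 (N * N), (f * f) n := by
  rw [sq, sum_mul_sum, ← sum_product', ArithmeticFunction.sum_Ioc_mul_eq_sum_prod_filter]
  refine sum_le_sum_of_subset_of_nonneg (fun x hx => ?_) fun x _ _ => mul_nonneg (hf _) (hf _)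
  simp only [mem_product, mem_Ioc, mem_filter] at hx ⊢
  obtain ⟨⟨h1, h1N⟩, h2, h2N⟩ := hx
  have hN : N ≤ N * N := Nat.le_mul_self N
  exact ⟨⟨⟨h1, h1N.trans hN⟩, h2, h2N.trans hN⟩, Nat.mul_le_mul h1N h2N⟩

lemma sum_Ioc_one_div_le_one_add_log (N : ℕ) : ∑ n ∈ Ioc 0 N, 1 / (n : ℝ) ≤ 1 + Real.log N := by
  have h := harmonic_le_one_add_log N
  rw [harmonic_eq_sum_Icc] at h
  push_cast at h
  simpa only [one_div, ← Icc_add_one_left_eq_Ioc, zero_add] using h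

/- The square is at most the sum over `n ≤ N ^ 2` of the Dirichlet coefficients of
`ζ (s + 1) * L (s + 1, χ)`, where `L (1, χ)` has bounded partial sums. -/
lemma reciprocalSum_splitNumbers_sq_le [NeZero q] (hχ : χ.IsQuadratic) (hχ1 : χ ≠ 1) (N : ℕ) :
    reciprocalSum (splitNumbers χ) N ^ 2 ≤ q * (1 + 2 * Real.log N) := by
  let split : ArithmeticFunction ℝ := ⟨(splitNumbers χ).indicator fun n => 1 / (n : ℝ), by simp⟩
  let inv : ArithmeticFunction ℝ := ⟨fun n => 1 / (n : ℝ), by simp⟩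
  let twist : ArithmeticFunction ℝ := ⟨fun n => (χ n : ℝ) / n, by simp⟩
  have split_nonneg : ∀ n, 0 ≤ split n := Set.indicator_nonneg fun _ _ => by positivity
  have sum_twist_le : ∀ n, ∑ m ∈ Ioc 0 n, twist m ≤ q := sum_div_le_of_forall_sum_le fun n => by
    exact_mod_cast sum_Ioc_le_of_isQuadratic hχ hχ1 n
  calc reciprocalSum (splitNumbers χ) N ^ 2 = (∑ n ∈ Ioc 0 N, split n) ^ 2 := by
        rw [reciprocalSum, sum_upTo]; rfl
    _ ≤ ∑ n ∈ Ioc 0 (N * N), (split * split) n := sq_sum_Ioc_le_sum_Ioc_mul split split_nonneg N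
    _ ≤ ∑ n ∈ Ioc 0 (N * N), (inv * twist) n := sum_le_sum fun n _ => by
        rw [ArithmeticFunction.mul_apply, ArithmeticFunction.mul_apply]
        exact sum_divisorsAntidiagonal_indicator_splitNumbers_le hχ n
    _ = ∑ n ∈ Ioc 0 (N * N), 1 / (n : ℝ) * ∑ m ∈ Ioc 0 (N * N / n), twist m :=
        ArithmeticFunction.sum_Ioc_mul_eq_sum_sum inv twist (N * N)
    _ ≤ (∑ n ∈ Ioc 0 (N * N), 1 / (n : ℝ)) * q := by
        rw [sum_mul]
        gcongr
        exact sum_twist_le _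
    _ ≤ (1 + Real.log (N * N : ℕ)) * q := by gcongr; exact sum_Ioc_one_div_le_one_add_log _
    _ = q * (1 + 2 * Real.log N) := by rw [Nat.cast_mul, ← sq, Real.log_pow]; push_cast; ring

lemma exists_eq_sq_mul_of_mem_evenInertNumbers (hχ : χ.IsQuadratic) {v : ℕ}
    (hv0 : v ≠ 0) (hv : v ∈ evenInertNumbers χ) :
    ∃ d r w : ℕ, v = d ^ 2 * (r * w) ∧ r ∣ q ∧ w ∈ splitNumbers χ := by
  obtain ⟨u, d, -, hd, rfl, hu⟩ := Nat.sq_mul_squarefree_of_pos (Nat.pos_of_ne_zero hv0)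
  obtain ⟨w, hw⟩ := Nat.gcd_dvd_left u q
  have hcop : (u.gcd q).Coprime w := Nat.coprime_of_squarefree_mul (hw ▸ hu)
  refine ⟨d, u.gcd q, w, by rw [← hw], Nat.gcd_dvd_right u q, fun p hp hpw => ?_⟩
  have hpu : p ∣ u := hpw.trans ⟨u.gcd q, by rw [mul_comm, ← hw]⟩
  have hpq : p.Coprime q := (hp.coprime_iff_not_dvd).mpr fun hpq =>
    Nat.not_coprime_of_dvd_of_dvd hp.one_lt (Nat.dvd_gcd hpu hpq) hpw hcop
  rcases hχ p with h | h | h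
  · exact absurd h (((ZMod.isUnit_iff_coprime p q).mpr hpq).map χ).ne_zero
  · exact h
  · have odd : (d ^ 2 * u).factorization p = 2 * d.factorization p + 1 := by
      rw [Nat.factorization_mul (by positivity) hu.ne_zero, Nat.factorization_pow,
        Finsupp.add_apply, Finsupp.smul_apply, smul_eq_mul,
        Nat.factorization_eq_one_of_squarefree hu hp hpu]
    exact absurd (odd ▸ hv p hp h) (by simp)

lemma card_upTo_evenInertNumbers_le [NeZero q] (hχ : χ.IsQuadratic) (N : ℕ) :
    #(upTo (evenInertNumbers χ) N) ≤
      #q.divisors * ∑ d ∈ Ioc 0 N, #(upTo (splitNumbers χ) (N / d ^ 2)) := by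
  classical
  have subset : upTo (evenInertNumbers χ) N ⊆ q.divisors.biUnion fun r => (Ioc 0 N).biUnion fun d =>
      (upTo (splitNumbers χ) (N / d ^ 2)).image fun w => d ^ 2 * (r * w) := by
    intro v hv
    obtain ⟨⟨hv0, hvN⟩, hv⟩ := mem_upTo.mp hv
    obtain ⟨d, r, w, rfl, hr, hw⟩ := exists_eq_sq_mul_of_mem_evenInertNumbers hχ hv0.ne' hv
    have hd : 0 < d := Nat.pos_of_ne_zero (by rintro rfl; simp at hv0)
    have hr0 : 0 < r := Nat.pos_of_dvd_of_pos hr (NeZero.pos q)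
    have hw0 : 0 < w := Nat.pos_of_ne_zero (by rintro rfl; simp at hv0)
    have hle : d ^ 2 * w ≤ N := by nlinarith [Nat.le_mul_of_pos_left w hr0, sq_nonneg d]
    simp only [mem_biUnion, mem_image, Nat.mem_divisors, mem_Ioc]
    refine ⟨r, ⟨hr, NeZero.ne q⟩, d, ⟨hd, by nlinarith⟩, w, mem_upTo.mpr ⟨⟨hw0, ?_⟩, hw⟩, rfl⟩
    rwa [Nat.le_div_iff_mul_le (by positivity), mul_comm]
  refine (card_le_card subset).trans (card_biUnion_le_card_mul _ _ _ fun r _ => ?_)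
  exact card_biUnion_le.trans (sum_le_sum fun d _ => card_image_le)

theorem exists_card_upTo_evenInertNumbers_le [NeZero q] (hχ : χ.IsQuadratic) (hχ1 : χ ≠ 1) :
    ∃ C : ℝ, 0 < C ∧ ∀ N : ℕ, 2 ≤ N →
      (#(upTo (evenInertNumbers χ) N) : ℝ) ≤ C * (N / √(Real.log N)) := by
  let K : ℝ := ∑' d : ℕ, (Real.log 4 + 5 + 2 * Real.log d) / (d : ℝ) ^ 2
  have hK : 0 < K := (summable_const_add_log_div_sq _).tsum_pos (fun d => by positivity) 1
    (by rw [Nat.cast_one]; positivity)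
  have hq : 0 < #q.divisors := card_pos.mpr (Nat.nonempty_divisors.mpr (NeZero.ne q))
  have hq0 : 0 < √(q : ℝ) := Real.sqrt_pos.mpr (by exact_mod_cast NeZero.pos q)
  refine ⟨#q.divisors * K * (2 * √q), by positivity, fun N hN => ?_⟩
  have hlog : 1 / 2 ≤ Real.log N := by
    have := Real.log_le_log two_pos (show (2 : ℝ) ≤ N by exact_mod_cast hN)
    linarith [Real.log_two_gt_d9]
  have hsqrt : 0 < √(Real.log N) := Real.sqrt_pos.mpr (by linarith)
  have reciprocalSum_le : reciprocalSum (splitNumbers χ) N ≤ 2 * √q * √(Real.log N) := by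
    refine (abs_le_of_sq_le_sq' ?_ (by positivity)).2
    have := reciprocalSum_splitNumbers_sq_le hχ hχ1 N
    rw [mul_pow, mul_pow, Real.sq_sqrt (by positivity), Real.sq_sqrt (by linarith)]
    nlinarith [q.cast_nonneg (α := ℝ)]
  rw [← mul_div_assoc, le_div_iff₀ hsqrt]
  refine le_of_mul_le_mul_right ?_ hsqrt
  calc (#(upTo (evenInertNumbers χ) N) : ℝ) * √(Real.log N) * √(Real.log N)
      = #(upTo (evenInertNumbers χ) N) * Real.log N := by
        rw [mul_assoc, Real.mul_self_sqrt (by linarith)]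
    _ ≤ #q.divisors * (∑ d ∈ Ioc 0 N, (#(upTo (splitNumbers χ) (N / d ^ 2)) : ℝ)) *
          Real.log N := by
        gcongr
        exact_mod_cast card_upTo_evenInertNumbers_le hχ N
    _ ≤ #q.divisors * (K * N * reciprocalSum (splitNumbers χ) N) := by
        rw [mul_assoc]
        refine mul_le_mul_of_nonneg_left ?_ (Nat.cast_nonneg _)
        exact sum_card_upTo_div_sq_mul_log_le (fun m n => mem_splitNumbers_of_dvd) N
    _ ≤ #q.divisors * (K * N * (2 * √q * √(Real.log N))) := by gcongr
    _ = _ := by ring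

end QuadraticCharacter

section InertPrimes

variable {a b : ℤ} {p : ℕ}

lemma exists_eq_natCast_mul_of_dvd_quadraticNorm (hp : p.Prime) (hp2 : p ≠ 2)
    (hΔ : ¬IsSquare ((b ^ 2 + 4 * a : ℤ) : ZMod p)) {x : QuadraticAlgebra ℤ a b}
    (hx : (p : ℤ) ∣ x.norm) : ∃ y, x = p * y := by
  have := Fact.mk hp
  have two_ne_zero : (2 : ZMod p) ≠ 0 := fun h => hp2 <|
    (Nat.prime_dvd_prime_iff_eq hp Nat.prime_two).mp
      ((ZMod.natCast_eq_zero_iff 2 p).mp (by exact_mod_cast h))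
  have hsq : (2 * (x.re : ZMod p) + b * x.im) ^ 2 = (b ^ 2 + 4 * a : ℤ) * (x.im : ZMod p) ^ 2 := by
    have := congrArg (Int.cast : ℤ → ZMod p) (four_mul_quadraticNorm x)
    rw [Int.cast_mul, (ZMod.intCast_zmod_eq_zero_iff_dvd _ p).mpr hx] at this
    push_cast at this ⊢
    linear_combination -this
  have him : (x.im : ZMod p) = 0 := by_contra fun him => hΔ (isSquare_of_sq_eq_mul_sq him hsq)
  have hre : (x.re : ZMod p) = 0 := by simpa [him, two_ne_zero] using hsq
  obtain ⟨r, hr⟩ := (ZMod.intCast_zmod_eq_zero_iff_dvd _ p).mp hre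
  obtain ⟨i, hi⟩ := (ZMod.intCast_zmod_eq_zero_iff_dvd _ p).mp him
  exact ⟨⟨r, i⟩, QuadraticAlgebra.ext (by simp [hr]) (by simp [hi])⟩

lemma even_factorization_natAbs_quadraticNorm (hp : p.Prime) (hp2 : p ≠ 2)
    (hΔ : ¬IsSquare ((b ^ 2 + 4 * a : ℤ) : ZMod p)) (x : QuadraticAlgebra ℤ a b) :
    Even (x.norm.natAbs.factorization p) := by
  induction h : x.norm.natAbs using Nat.strong_induction_on generalizing x with
  | _ n ih =>
    subst h
    by_cases hpx : p ∣ x.norm.natAbs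
    · obtain ⟨y, rfl⟩ := exists_eq_natCast_mul_of_dvd_quadraticNorm hp hp2 hΔ
        (Int.natCast_dvd.mpr hpx)
      have hnorm : ((p : QuadraticAlgebra ℤ a b) * y).norm.natAbs = p ^ 2 * y.norm.natAbs := by
        simp [Int.natAbs_mul, Int.natAbs_pow]
      rcases Nat.eq_zero_or_pos y.norm.natAbs with hy | hy
      · rw [hnorm, hy, mul_zero, Nat.factorization_zero, Finsupp.zero_apply]
        exact Even.zero
      have hlt : y.norm.natAbs < p ^ 2 * y.norm.natAbs :=
        lt_mul_of_one_lt_left hy (Nat.one_lt_pow two_ne_zero hp.one_lt)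
      rw [hnorm, Nat.factorization_mul (pow_pos hp.pos 2).ne' hy.ne', Finsupp.add_apply,
        hp.factorization_pow, Finsupp.single_eq_same]
      exact even_two.add (ih _ (hnorm ▸ hlt) y rfl)
    · simp [Nat.factorization_eq_zero_of_not_dvd hpx]

variable {q : ℕ} {χ : DirichletCharacter ℤ q}

lemma card_sqDistances_le_card_upTo (hΔ : b ^ 2 + 4 * a < 0)
    (hinert : ∀ p : ℕ, p.Prime → χ p = -1 → p ≠ 2 ∧ ¬IsSquare ((b ^ 2 + 4 * a : ℤ) : ZMod p))
    {s : Finset (QuadraticAlgebra ℤ a b)} (hs : ∀ p ∈ s, ∀ q ∉ s, p.norm ≤ q.norm) :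
    #(sqDistances s) ≤
      #(upTo (evenInertNumbers χ) (4 * (1 + a.natAbs + b.natAbs) * #s)) := by
  refine card_le_card_of_injOn Int.natAbs (fun r hr => ?_)
    (Int.injOn_natAbs_Ici.mono fun r hr => (pos_of_mem_sqDistances hΔ hr).le)
  have hpos := pos_of_mem_sqDistances hΔ hr
  refine mem_upTo.mpr ⟨⟨Int.natAbs_pos.mpr hpos.ne', ?_⟩, fun p hp hχp => ?_⟩
  · zify
    rw [abs_of_pos hpos]
    exact mem_sqDistances_le_mul_card hΔ hs hr
  · obtain ⟨hp2, hsq⟩ := hinert p hp hχp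
    obtain ⟨⟨x, y⟩, -, rfl⟩ := mem_image.mp hr
    exact even_factorization_natAbs_quadraticNorm hp hp2 hsq _

theorem exists_card_sqDistances_le [NeZero q] (hχ : χ.IsQuadratic) (hχ1 : χ ≠ 1)
    (hΔ : b ^ 2 + 4 * a < 0)
    (hinert : ∀ p : ℕ, p.Prime → χ p = -1 → p ≠ 2 ∧ ¬IsSquare ((b ^ 2 + 4 * a : ℤ) : ZMod p)) :
    ∃ C : ℝ, 0 < C ∧ ∀ s : Finset (QuadraticAlgebra ℤ a b), 2 ≤ #s →
      (∀ p ∈ s, ∀ q ∉ s, p.norm ≤ q.norm) →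
        (#(sqDistances s) : ℝ) ≤ C * (#s / √(Real.log #s)) := by
  obtain ⟨C, hC, hbound⟩ := exists_card_upTo_evenInertNumbers_le hχ hχ1
  let M : ℕ := 4 * (1 + a.natAbs + b.natAbs)
  have hM : 0 < M := by positivity
  refine ⟨M * C, by positivity, fun s hcard hs => ?_⟩
  have hle : #s ≤ M * #s := Nat.le_mul_of_pos_left _ hM
  have hlog : 0 < Real.log #s := Real.log_pos (by exact_mod_cast hcard)
  calc (#(sqDistances s) : ℝ) ≤ #(upTo (evenInertNumbers χ) (M * #s)) := by
        exact_mod_cast card_sqDistances_le_card_upTo hΔ hinert hs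
    _ ≤ C * ((M * #s : ℕ) / √(Real.log (M * #s : ℕ))) := hbound _ (hcard.trans hle)
    _ ≤ C * ((M * #s : ℕ) / √(Real.log #s)) := by gcongr
    _ = M * C * (#s / √(Real.log #s)) := by push_cast; ring

end InertPrimes

section SqrtNegSeven

lemma not_isSquare_neg_of_quadraticChar_eq_neg_one {ℓ p : ℕ} [Fact ℓ.Prime] (hℓ : ℓ % 8 = 7)
    (hp : p.Prime) (h : quadraticChar (ZMod ℓ) p = -1) : p ≠ 2 ∧ ¬IsSquare (-ℓ : ZMod p) := by
  have := Fact.mk hp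
  have hℓ2 : ℓ ≠ 2 := by omega
  have hp2 : p ≠ 2 := by
    rintro rfl
    exact quadraticChar_neg_one_iff_not_isSquare.mp h
      (by exact_mod_cast (ZMod.exists_sq_eq_two_iff hℓ2).mpr (.inr hℓ))
  have hℓp : ringChar (ZMod ℓ) ≠ p := by
    rw [ZMod.ringChar_zmod_n]
    rintro rfl
    simp at h
  have hχ₄ : ZMod.χ₄ ℓ = -1 := ZMod.χ₄_nat_three_mod_four (by omega)
  rw [quadraticChar_odd_prime (by rwa [ZMod.ringChar_zmod_n]) hp2 hℓp, ZMod.card, hχ₄,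
    quadraticChar_neg_one_iff_not_isSquare] at h
  exact ⟨hp2, by simpa using h⟩

theorem exists_ncard_distances_le : ∃ C : ℝ, 0 < C ∧ ∀ (n : ℕ) (P : Finset Plane), 2 ≤ n →
    IsNearestLatticePoints n P →
      ((distances (P : Set Plane)).ncard : ℝ) ≤ C * (n / √(Real.log n)) := by
  have : Fact (Nat.Prime 7) := ⟨by norm_num⟩
  have hΔ : (1 : ℤ) ^ 2 + 4 * -2 < 0 := by norm_num
  obtain ⟨C, hC, hbound⟩ := exists_card_sqDistances_le (quadraticChar_isQuadratic (ZMod 7))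
    (quadraticChar_ne_one (by simp [ZMod.ringChar_zmod_n])) hΔ fun p hp h => by
      simpa using not_isSquare_neg_of_quadraticChar_eq_neg_one (ℓ := 7) rfl hp h
  refine ⟨C, hC, fun n P hn hP => ?_⟩
  obtain ⟨s, hsP, rfl, hs⟩ := isNearestLatticePoints_iff.mp hP
  rw [← hsP, ncard_distances_image_toPlane hΔ]
  exact hbound s hn hs

end SqrtNegSeven

end

theorem mainTheorem6 :
    FourPointsThreeDistances latticeSeven ∧
    (∀ n : ℕ, ∃ P : Finset Plane, IsNearestLatticePoints n P) ∧
    (∀ (n : ℕ) (P : Finset Plane), IsNearestLatticePoints n P →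
      FourPointsThreeDistances (P : Set Plane)) ∧
    (∃ C : ℝ, 0 < C ∧ ∀ (n : ℕ) (P : Finset Plane), 2 ≤ n → IsNearestLatticePoints n P →
      ((distances (P : Set Plane)).ncard : ℝ) ≤ C * ((n : ℝ) / Real.sqrt (Real.log n))) :=
  ⟨fourPointsThreeDistances_latticeSeven, exists_isNearestLatticePoints,
    fun _ _ hP => fourPointsThreeDistances_latticeSeven.mono hP.1, exists_ncard_distances_le⟩
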